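/- Let $0\le p\le 1$, $q\ge 0$, $0\le r<1$ and $P,\sigma^2>0$ be fixed, put $\rho=P/\sigma^2$, and let $\delta=p+r-1$. For every integer $M\ge 1$ let $K=K_M$ and $L=L_M$ be integers with $|K-M^p|<1$ and $|L-M^q|<1$ (so $K=M^p$ and $L=M^q$ up to rounding), and let $R=R_M$ and $H=H_M>0$ be reals with $R/H=M^{-r}$. For $N\ge1$ and $x\in\mathbb R$ put $\mathbf a(x;N)=\frac1{\sqrt N}\bigl[1,e^{j2\pi x},\dots,e^{j2\pi(N-1)x}\bigr]^{\mathsf T}$. Let $(u_k,\omega_k)$, $k=1,\dots,K$, be i.i.d. uniform on $[-\frac{R}{2H},\frac{R}{2H}]\times[-\frac12,\frac12]$ (spatial frequency and normalized Doppler frequency of user $k$). With $\mathbf a_k=\mathbf a(u_k;M)$ and $\mathbf b_k=\mathbf a(\omega_k;L)$, let $\bar{\mathbf H}=[\bar{\mathbf h}_1,\dots,\bar{\mathbf h}_K]\in\mathbb C^{ML\times K}$ be the space-time channel matrix (uniform linear array of $M$ elements, $L$ snapshots) with columns $\bar{\mathbf h}_k=\sqrt{ML}\,(\mathbf b_k\otimes\mathbf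 a_k)$, and let $\bar{\mathbf F}=[\bar{\mathbf f}_1,\dots,\bar{\mathbf f}_K]=\bar\eta\,\bar{\mathbf H}(\bar{\mathbf H}^{\mathsf H}\bar{\mathbf H})^{-1}$ with $\bar\eta=\sqrt{L/\operatorname{tr}((\bar{\mathbf H}^{\mathsf H}\bar{\mathbf H})^{-1})}$ be the zero-forcing precoder ($\bar{\mathbf F}=0$ on the null event that $\bar{\mathbf H}^{\mathsf H}\bar{\mathbf H}$ is singular). Let $$\overline{\mathrm{SINR}}_k=\frac{\frac PL|\bar{\mathbf h}_k^{\mathsf H}\bar{\mathbf f}_k|^2}{\frac PL\sum_{i\ne k}|\bar{\mathbf h}_k^{\mathsf H}\bar{\mathbf f}_i|^2+\sigma^2},\qquad \bar R_\Sigma=\frac1L\sum_{k=1}^K\log_2\bigl(1+\overline{\mathrm{SINR}}_k\bigr);$$ almost surely $\overline{\mathrm{SINR}}_k=\rho ML/\operatorname{tr}(\bar{\mathbf G}^{-1})$ with $\bar{\mathbf G}=\frac1{ML}\bar{\mathbf H}^{\mathsf H}\bar{\mathbf H}$. Then $\bar R_\Sigma$ is integrable for every $M\ge1$, and as $M\to\infty$: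 (i) (sparse/critical regime) if $q\ge\delta$, then $\mathbb E[\bar R_\Sigma]=O\bigl(M^{p-q}\log M\bigr)$; (ii) (dense regime) if $q<\delta$, then $\mathbb E[\bar R_\Sigma]\to0$. -/

import Mathlib

open MeasureTheory ProbabilityTheory Filter Asymptotics

noncomputable section

namespace STAB

/-- The array response vector `a(x; N) = N^{-1/2} (1, e^{j2πx}, …, e^{j2π(N-1)x})`. -/
def response (N : ℕ) (x : ℝ) (m : Fin N) : ℂ :=
  ((1 / Real.sqrt N : ℝ) : ℂ) * Complex.exp (2 * Real.pi * Complex.I * ((m : ℕ) : ℂ) * (x : ℂ))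

/-- The space-time channel matrix of `K` users. User `k` has spatial frequency `(θ k).1` and
normalized Doppler frequency `(θ k).2`; column `k` is `√(ML) (b_k ⊗ a_k)`, where `a_k` is the
spatial response of length `M` and `b_k` the temporal response of length `L`. -/
def channel (M L K : ℕ) (θ : Fin K → ℝ × ℝ) : Matrix (Fin L × Fin M) (Fin K) ℂ :=
  fun i k => ((Real.sqrt ((M : ℝ) * L) : ℝ) : ℂ) *
    (response L (θ k).2 i.1 * response M (θ k).1 i.2)

/-- The power normalization `η = √(L / tr((HᴴH)⁻¹))` of the zero-forcing precoder. -/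
def zfScale {ι : Type*} [Fintype ι] {K : ℕ} (L : ℕ) (H : Matrix ι (Fin K) ℂ) : ℝ :=
  Real.sqrt ((L : ℝ) / ((H.conjTranspose * H)⁻¹).trace.re)

/-- The zero-forcing precoder `F = η H (HᴴH)⁻¹`. If `HᴴH` is singular (a null event for the users
considered here) this is the zero matrix: nothing is transmitted and all rates are `0`. -/
def zfPrecoder {ι : Type*} [Fintype ι] {K : ℕ} (L : ℕ) (H : Matrix ι (Fin K) ℂ) :
    Matrix ι (Fin K) ℂ :=
  (zfScale L H : ℂ) • (H * (H.conjTranspose * H)⁻¹)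

/-- The SINR of user `k` for the received signal `y = √(P/L) HᴴF s + z`, where the symbols `s`
are independent of unit power and the noise `z` has variance `σsq` per user. -/
def sinr {ι : Type*} [Fintype ι] {K : ℕ} (L : ℕ) (P σsq : ℝ) (H F : Matrix ι (Fin K) ℂ)
    (k : Fin K) : ℝ :=
  (P / L * ‖(H.conjTranspose * F) k k‖ ^ 2) /
    (P / L * ∑ i ∈ Finset.univ.erase k, ‖(H.conjTranspose * F) k i‖ ^ 2 + σsq)

/-- The instantaneous sum rate of zero-forcing on the space-time channel, in bits per snapshot:
each symbol vector occupies `L` snapshots, whence the factor `1/L`. -/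
def sumRate (M L K : ℕ) (P σsq : ℝ) (θ : Fin K → ℝ × ℝ) : ℝ :=
  1 / (L : ℝ) * ∑ k : Fin K, Real.logb 2
    (1 + sinr L P σsq (channel M L K θ) (zfPrecoder L (channel M L K θ)) k)

/-- The law of the user parameters: the pairs (spatial frequency, Doppler frequency) are i.i.d.
uniform on `[-R/(2H), R/(2H)] × [-1/2, 1/2]`. -/
def userLaw (K : ℕ) (R H : ℝ) : Measure (Fin K → ℝ × ℝ) :=
  Measure.pi fun _ : Fin K =>
    (cond (volume : Measure ℝ) (Set.Icc (-(R / (2 * H))) (R / (2 * H)))).prod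
      (cond (volume : Measure ℝ) (Set.Icc (-(1 / 2)) (1 / 2)))

/-- The average sum rate: the expectation of `sumRate` over the users' locations and Dopplers. -/
def avgSumRate (M L K : ℕ) (P σsq R H : ℝ) : ℝ :=
  ∫ θ, sumRate M L K P σsq θ ∂(userLaw K R H)

end STAB

end

/-! For an invertible Gram matrix, zero-forcing removes the interference and SINR = ρ / tr((HᴴH)⁻¹).
The trace dominates the largest eigenvalue of (HᴴH)⁻¹, so the SINR is at most ρ‖Hv‖²/‖v‖² for every
v ≠ 0 (`sinr_zfPrecoder_le`), and each regime needs only a good v.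

A coordinate vector gives SINR ≤ ρML, hence a rate at most (K/L) log₂(1 + ρML), which is (i).

For (ii), the phases satisfy |2πmu| ≤ πM^(1-r), so e^(2πimu) agrees with its Taylor polynomial of D
~ M^(1-r) terms up to an error of order 2^(-D). Up to that error the channel has rank at most LD ~
M^(q+1-r), far below K ~ M^p when q < δ. A kernel vector of the truncated channel makes the SINR
exponentially small in M^(1-r), which beats the polynomial factors (`sinr_channel_le_of_dense`). -/

namespace STAB

/-! ### Zero-forcing SINR and Rayleigh quotients -/

/-- Every test vector `v` gives a lower bound on the trace of the inverse Gram matrix. -/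
lemma sum_norm_sq_le_trace_inv_mul {ι : Type*} [Fintype ι] {K : ℕ} (H : Matrix ι (Fin K) ℂ)
    (hdet : IsUnit (H.conjTranspose * H).det) (v : Fin K → ℂ) :
    ∑ k, ‖v k‖ ^ 2 ≤ ((H.conjTranspose * H)⁻¹).trace.re * ∑ i, ‖(H.mulVec v) i‖ ^ 2 := by
  set A := H.conjTranspose * H with hA
  set F := H * A⁻¹ with hF
  have hAinv : (A⁻¹).conjTranspose = A⁻¹ := by
    rw [Matrix.conjTranspose_nonsing_inv, hA, Matrix.conjTranspose_mul,
      Matrix.conjTranspose_conjTranspose]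
  -- `F` is the pseudo-inverse: v = Fᴴ(Hv) and tr(A⁻¹) is its squared Frobenius norm, so
  -- Cauchy–Schwarz on each coordinate of v suffices.
  have hFH : F.conjTranspose * H = 1 := by
    rw [hF, Matrix.conjTranspose_mul, hAinv, Matrix.mul_assoc, ← hA, Matrix.nonsing_inv_mul _ hdet]
  have hFF : F.conjTranspose * F = A⁻¹ := by
    conv_lhs => rw [hF, ← Matrix.mul_assoc, hFH, Matrix.one_mul]
  have htr : (A⁻¹).trace.re = ∑ k, ∑ i, ‖F i k‖ ^ 2 := by
    rw [← hFF, Matrix.trace, Complex.re_sum]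
    refine Finset.sum_congr rfl fun k _ => ?_
    rw [Matrix.diag_apply, Matrix.mul_apply, Complex.re_sum]
    refine Finset.sum_congr rfl fun i _ => ?_
    rw [Matrix.conjTranspose_apply, Complex.star_def, mul_comm, Complex.mul_conj,
      Complex.ofReal_re, Complex.normSq_eq_norm_sq]
  have hv : F.conjTranspose.mulVec (H.mulVec v) = v := by
    rw [Matrix.mulVec_mulVec, hFH, Matrix.one_mulVec]
  rw [htr, Finset.sum_mul]
  refine Finset.sum_le_sum fun k _ => ?_
  have hvk : ‖v k‖ ≤ ∑ i, ‖F i k‖ * ‖(H.mulVec v) i‖ := by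
    conv_lhs => rw [← hv]
    refine (norm_sum_le _ _).trans (le_of_eq ?_)
    refine Finset.sum_congr rfl fun i _ => ?_
    rw [norm_mul]
    congr 1
    exact norm_star (F i k)
  exact (pow_le_pow_left₀ (norm_nonneg _) hvk 2).trans
    (Finset.sum_mul_sq_le_sq_mul_sq _ _ _)

lemma sinr_nonneg {ι : Type*} [Fintype ι] {K : ℕ} (L : ℕ) {P σsq : ℝ} (hP : 0 ≤ P)
    (hσ : 0 ≤ σsq) (H F : Matrix ι (Fin K) ℂ) (k : Fin K) : 0 ≤ sinr L P σsq H F k := by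
  unfold sinr
  positivity

/-- The zero-forcing SINR is at most the Rayleigh quotient of any nonzero test vector. -/
lemma sinr_zfPrecoder_le {ι : Type*} [Fintype ι] {K L : ℕ} (hL : 0 < L) {P σsq : ℝ} (hP : 0 < P)
    (hσ : 0 < σsq) (H : Matrix ι (Fin K) ℂ) (k : Fin K) {v : Fin K → ℂ} (hv : v ≠ 0) {B : ℝ}
    (hB : ∑ i, ‖(H.mulVec v) i‖ ^ 2 ≤ B * ∑ k, ‖v k‖ ^ 2) :
    sinr L P σsq H (zfPrecoder L H) k ≤ P / σsq * B := by
  have hLpos : (0 : ℝ) < L := Nat.cast_pos.2 hL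
  have hvpos : 0 < ∑ k, ‖v k‖ ^ 2 := by
    obtain ⟨j, hj⟩ := Function.ne_iff.1 hv
    exact Finset.sum_pos' (fun _ _ => by positivity)
      ⟨j, Finset.mem_univ _, pow_pos (norm_pos_iff.2 hj) 2⟩
  have hB0 : 0 ≤ B := by
    by_contra! h
    have h1 : 0 ≤ ∑ i, ‖(H.mulVec v) i‖ ^ 2 := Finset.sum_nonneg fun _ _ => by positivity
    nlinarith [mul_neg_of_neg_of_pos h hvpos]
  by_cases hdet : IsUnit (H.conjTranspose * H).det
  · have hHF : H.conjTranspose * zfPrecoder L H = (zfScale L H : ℂ) • 1 := by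
      rw [zfPrecoder, Matrix.mul_smul, ← Matrix.mul_assoc, Matrix.mul_nonsing_inv _ hdet]
    have hoff : ∑ i ∈ Finset.univ.erase k, ‖(H.conjTranspose * zfPrecoder L H) k i‖ ^ 2 = 0 := by
      refine Finset.sum_eq_zero fun i hi => ?_
      rw [hHF, Matrix.smul_apply, Matrix.one_apply_ne (Finset.ne_of_mem_erase hi).symm]
      simp
    have hdiag : ‖(H.conjTranspose * zfPrecoder L H) k k‖ ^ 2 = zfScale L H ^ 2 := by
      rw [hHF, Matrix.smul_apply, Matrix.one_apply_eq]
      simp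
    have hmain := sum_norm_sq_le_trace_inv_mul H hdet v
    have hone : 1 ≤ ((H.conjTranspose * H)⁻¹).trace.re * B := by
      have h0 : 0 ≤ ((H.conjTranspose * H)⁻¹).trace.re := by
        by_contra! h
        have h1 : 0 ≤ ∑ i, ‖(H.mulVec v) i‖ ^ 2 := Finset.sum_nonneg fun _ _ => by positivity
        nlinarith [mul_nonneg (neg_nonneg.2 h.le) h1]
      refine le_of_mul_le_mul_right ?_ hvpos
      calc 1 * ∑ k, ‖v k‖ ^ 2 ≤ _ := by rw [one_mul]; exact hmain
        _ ≤ _ := mul_le_mul_of_nonneg_left hB h0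
        _ = _ := (mul_assoc _ _ _).symm
    have htr : 0 < ((H.conjTranspose * H)⁻¹).trace.re :=
      pos_of_mul_pos_left (one_pos.trans_le hone) hB0
    rw [sinr, hoff, hdiag, zfScale, Real.sq_sqrt (by positivity), mul_zero, zero_add]
    have : P / L * (L / ((H.conjTranspose * H)⁻¹).trace.re) / σsq
        = P / σsq * (1 / ((H.conjTranspose * H)⁻¹).trace.re) := by
      field_simp
    rw [this]
    refine mul_le_mul_of_nonneg_left ?_ (by positivity)
    rw [div_le_iff₀ htr, mul_comm]
    exact hone
  -- A singular Gram matrix has inverse 0 by convention, so the SINR is 0; `hB0` then closes the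
  -- bound.
  · have : zfPrecoder L H = 0 := by
      rw [zfPrecoder, Matrix.nonsing_inv_apply_not_isUnit _ hdet, Matrix.mul_zero, smul_zero]
    rw [this, sinr]
    simp only [Matrix.mul_zero, Matrix.zero_apply, norm_zero]
    simp only [ne_eq, OfNat.ofNat_ne_zero, not_false_eq_true, zero_pow, mul_zero, zero_div]
    positivity

/-! ### SINR bounds for the space-time channel -/

lemma norm_response {N : ℕ} (x : ℝ) (m : Fin N) : ‖response N x m‖ = 1 / Real.sqrt N := by
  have : (2 * Real.pi * Complex.I * ((m : ℕ) : ℂ) * (x : ℂ))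
      = ((2 * Real.pi * (m : ℕ) * x : ℝ) : ℂ) * Complex.I := by
    push_cast; ring
  rw [response, norm_mul, this, Complex.norm_exp_ofReal_mul_I, mul_one, Complex.norm_real,
    Real.norm_of_nonneg (by positivity)]

lemma norm_channel {M L K : ℕ} (θ : Fin K → ℝ × ℝ) (i : Fin L × Fin M) (k : Fin K) :
    ‖channel M L K θ i k‖ = 1 := by
  have hL : 0 < Real.sqrt L := Real.sqrt_pos.2 (Nat.cast_pos.2 i.1.pos)
  have hM : 0 < Real.sqrt M := Real.sqrt_pos.2 (Nat.cast_pos.2 i.2.pos)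
  rw [channel, norm_mul, norm_mul, norm_response, norm_response, Complex.norm_real,
    Real.norm_of_nonneg (by positivity), Real.sqrt_mul (by positivity)]
  field_simp

lemma sinr_channel_le {M L K : ℕ} (hL : 0 < L) {P σsq : ℝ} (hP : 0 < P) (hσ : 0 < σsq)
    (θ : Fin K → ℝ × ℝ) (k : Fin K) :
    sinr L P σsq (channel M L K θ) (zfPrecoder L (channel M L K θ)) k
      ≤ P / σsq * ((M : ℝ) * L) := by
  refine sinr_zfPrecoder_le hL hP hσ _ k (v := Pi.single k 1) (by simp) ?_
  have h1 : ∑ j, ‖(Pi.single k 1 : Fin K → ℂ) j‖ ^ 2 = 1 := by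
    rw [Finset.sum_eq_single k]
    · simp
    · intro j _ hj
      simp [hj]
    · simp
  rw [h1]
  simp [norm_channel, mul_comm]

/-- The remainder is at most 2|z|^D/D!, and |z|^D/D! ≤ 8^(-D) e^(8|z|) ≤ (e/8)^D ≤ 2^(-D). -/
lemma norm_exp_sub_sum_le_two_mul_inv_pow {z : ℂ} {D : ℕ} (hz : 8 * ‖z‖ ≤ D) :
    ‖Complex.exp z - ∑ d ∈ Finset.range D, z ^ d / (d.factorial : ℂ)‖ ≤ 2 * (1 / 2) ^ D := by
  have h0 := norm_nonneg z
  have hb : ‖z‖ / (D.succ : ℝ) ≤ 1 / 2 := by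
    rw [div_le_iff₀ (by positivity)]
    push_cast
    linarith
  refine (Complex.exp_bound' hb).trans ?_
  have h1 : (8 * ‖z‖) ^ D / (D.factorial : ℝ) ≤ Real.exp 1 ^ D := by
    rw [← Real.exp_nat_mul, mul_one]
    exact (Real.pow_div_factorial_le_exp _ (by positivity) D).trans (Real.exp_le_exp.2 hz)
  have h2 : Real.exp 1 ^ D ≤ 4 ^ D :=
    pow_le_pow_left₀ (Real.exp_nonneg _) (by linarith [Real.exp_one_lt_d9]) D
  have h3 : ‖z‖ ^ D / (D.factorial : ℝ) = (1 / 8) ^ D * ((8 * ‖z‖) ^ D / D.factorial) := by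
    rw [← mul_div_assoc, ← mul_pow]
    ring_nf
  have h4 : ‖z‖ ^ D / (D.factorial : ℝ) ≤ (1 / 8) ^ D * 4 ^ D := by
    rw [h3]
    exact mul_le_mul_of_nonneg_left (h1.trans h2) (by positivity)
  rw [← mul_pow] at h4
  norm_num at h4 ⊢
  linarith

/-- If all spatial frequencies are small, the channel vectors are exponentially close to a space
of dimension `L * D`; for `K > L * D` users the SINR is then exponentially small. -/
lemma sinr_channel_le_of_dense {M L K D : ℕ} (hL : 0 < L) {P σsq : ℝ} (hP : 0 < P)
    (hσ : 0 < σsq) (θ : Fin K → ℝ × ℝ) (k : Fin K) (hK : L * D < K)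
    (hθ : ∀ k, 8 * (2 * Real.pi * M * |(θ k).1|) ≤ D) :
    sinr L P σsq (channel M L K θ) (zfPrecoder L (channel M L K θ)) k
      ≤ P / σsq * ((M : ℝ) * L * K * (4 * (1 / 4) ^ D)) := by
  -- The Taylor term (2πimu)^d/d! without its factor m^d, which depends only on the row: `T` has
  -- just LD rows, and its kernel annihilates the truncated channel for every m at once.
  let T : Matrix (Fin L × Fin D) (Fin K) ℂ := fun i k =>
    response L (θ k).2 i.1 *
      ((2 * Real.pi * Complex.I * ((θ k).1 : ℂ)) ^ (i.2 : ℕ) / ((i.2 : ℕ).factorial : ℂ))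
  obtain ⟨v, hv, hv0⟩ : ∃ v, T.mulVec v = 0 ∧ v ≠ 0 := by
    have hker : LinearMap.ker T.mulVecLin ≠ ⊥ :=
      LinearMap.ker_ne_bot_of_finrank_lt (by simpa using hK)
    obtain ⟨v, hv, hv0⟩ := (Submodule.ne_bot_iff _).1 hker
    exact ⟨v, by simpa using hv, hv0⟩
  refine sinr_zfPrecoder_le hL hP hσ _ k hv0 ?_
  have hentry : ∀ i, ‖((channel M L K θ).mulVec v) i‖ ≤ 2 * (1 / 2) ^ D * ∑ k, ‖v k‖ := by
    rintro ⟨l, m⟩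
    have hsL : 0 < Real.sqrt L := Real.sqrt_pos.2 (Nat.cast_pos.2 l.pos)
    have hsM : 0 < Real.sqrt M := Real.sqrt_pos.2 (Nat.cast_pos.2 m.pos)
    let z : Fin K → ℂ := fun k => 2 * Real.pi * Complex.I * ((m : ℕ) : ℂ) * ((θ k).1 : ℂ)
    have hz : ∀ k, 8 * ‖z k‖ ≤ D := by
      intro k
      have : ‖z k‖ = 2 * Real.pi * (m : ℕ) * |(θ k).1| := by
        simp [z, abs_of_pos Real.pi_pos]
      rw [this]
      refine le_trans ?_ (hθ k)
      have : ((m : ℕ) : ℝ) ≤ M := Nat.cast_le.2 m.2.le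
      gcongr
    have hpoly : ∑ k, Real.sqrt L * response L (θ k).2 l *
        (∑ d ∈ Finset.range D, z k ^ d / (d.factorial : ℂ)) * v k = 0 := by
      have hd : ∀ d : Fin D, ∑ k, T (l, d) k * v k = 0 := fun d => congrFun hv (l, d)
      simp only [← Fin.sum_univ_eq_sum_range (fun d => z _ ^ d / (d.factorial : ℂ)),
        Finset.mul_sum, Finset.sum_mul]
      rw [Finset.sum_comm]
      refine Finset.sum_eq_zero fun d _ => ?_
      rw [← mul_zero ((Real.sqrt L : ℂ) * ((m : ℕ) : ℂ) ^ (d : ℕ)), ← hd d, Finset.mul_sum]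
      refine Finset.sum_congr rfl fun k _ => ?_
      simp only [T, z, mul_pow]
      ring
    have hsum : ((channel M L K θ).mulVec v) (l, m) = ∑ k, Real.sqrt L * response L (θ k).2 l *
        (Complex.exp (z k) - ∑ d ∈ Finset.range D, z k ^ d / (d.factorial : ℂ)) * v k := by
      have hexp : ((channel M L K θ).mulVec v) (l, m)
          = ∑ k, Real.sqrt L * response L (θ k).2 l * Complex.exp (z k) * v k := by
        rw [Matrix.mulVec_eq_sum, Finset.sum_apply]
        refine Finset.sum_congr rfl fun k _ => ?_
        simp only [Pi.smul_apply, MulOpposite.smul_eq_mul_unop, MulOpposite.unop_op,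
          Matrix.transpose_apply]
        congr 1
        have hne : (Real.sqrt M : ℂ) ≠ 0 := Complex.ofReal_ne_zero.2 hsM.ne'
        rw [channel, response.eq_1 M, Real.sqrt_mul (by positivity)]
        simp only [z]
        push_cast
        field_simp
      refine (hexp.trans (sub_zero _).symm).trans ?_
      rw [← hpoly, ← Finset.sum_sub_distrib]
      refine Finset.sum_congr rfl fun k _ => ?_
      ring
    rw [hsum, Finset.mul_sum]
    refine (norm_sum_le _ _).trans (Finset.sum_le_sum fun k _ => ?_)
    rw [norm_mul, norm_mul, norm_mul, norm_response, Complex.norm_real,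
      Real.norm_of_nonneg hsL.le, mul_one_div_cancel hsL.ne', one_mul]
    exact mul_le_mul_of_nonneg_right (norm_exp_sub_sum_le_two_mul_inv_pow (hz k)) (norm_nonneg _)
  have hcs : (∑ k, ‖v k‖) ^ 2 ≤ K * ∑ k, ‖v k‖ ^ 2 := by
    simpa using sq_sum_le_card_mul_sum_sq (s := Finset.univ) (f := fun k => ‖v k‖)
  calc ∑ i, ‖((channel M L K θ).mulVec v) i‖ ^ 2
      ≤ ∑ _i : Fin L × Fin M, (2 * (1 / 2) ^ D * ∑ k, ‖v k‖) ^ 2 :=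
        Finset.sum_le_sum fun i _ => pow_le_pow_left₀ (norm_nonneg _) (hentry i) 2
    _ = (M : ℝ) * L * (4 * (1 / 4) ^ D) * (∑ k, ‖v k‖) ^ 2 := by
        have : ((1 / 4 : ℝ)) ^ D = ((1 / 2) ^ D) ^ 2 := by
          rw [← pow_mul, mul_comm, pow_mul]; norm_num
        rw [this]
        simp only [Finset.sum_const, Finset.card_univ, Fintype.card_prod, Fintype.card_fin,
          nsmul_eq_mul]
        push_cast
        ring
    _ ≤ (M : ℝ) * L * (4 * (1 / 4) ^ D) * (K * ∑ k, ‖v k‖ ^ 2) := by gcongr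
    _ = _ := by ring

/-! ### Measurability, integrability and averaged bounds -/

lemma continuous_channel (M L K : ℕ) : Continuous (channel M L K) := by
  refine continuous_matrix fun i k => ?_
  simp only [channel, response]
  fun_prop

/-- By Cramer's rule the only discontinuity comes from inverting the determinant, which is still
measurable at 0. -/
lemma measurable_inv_apply {X n : Type*} [TopologicalSpace X] [MeasurableSpace X]
    [OpensMeasurableSpace X] [Fintype n] [DecidableEq n] {A : X → Matrix n n ℂ}
    (hA : Continuous A) (i j : n) : Measurable fun x => (A x)⁻¹ i j := by
  simp only [Matrix.inv_def, Ring.inverse_eq_inv', Matrix.smul_apply, smul_eq_mul]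
  exact hA.matrix_det.measurable.inv.mul (hA.matrix_adjugate.matrix_elem i j).measurable

lemma measurable_sumRate (M L K : ℕ) (P σsq : ℝ) : Measurable (sumRate M L K P σsq) := by
  have hH := continuous_channel M L K
  have hHij : ∀ i k, Measurable fun θ => channel M L K θ i k :=
    fun i k => (hH.matrix_elem i k).measurable
  have hG := measurable_inv_apply (hH.matrix_conjTranspose.matrix_mul hH)
  have hη : Measurable fun θ => zfScale L (channel M L K θ) := by
    unfold zfScale Matrix.trace
    refine (measurable_const.div (Complex.measurable_re.comp ?_)).sqrt
    exact Finset.measurable_sum _ fun k _ => hG k k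
  have hF : ∀ i k, Measurable fun θ => zfPrecoder L (channel M L K θ) i k := by
    intro i k
    simp only [zfPrecoder, Matrix.smul_apply, smul_eq_mul, Matrix.mul_apply (M := channel M L K _)]
    exact (Complex.measurable_ofReal.comp hη).mul
      (Finset.measurable_sum _ fun j _ => (hHij i j).mul (hG j k))
  have hHF : ∀ k i, Measurable fun θ =>
      ‖((channel M L K θ).conjTranspose * zfPrecoder L (channel M L K θ)) k i‖ ^ 2 := by
    intro k i
    simp only [Matrix.mul_apply, Matrix.conjTranspose_apply]
    refine Measurable.pow_const (Measurable.norm ?_) 2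
    exact Finset.measurable_sum _ fun j _ =>
      (continuous_star.measurable.comp (hHij j k)).mul (hF j i)
  unfold sumRate sinr Real.logb
  refine measurable_const.mul (Finset.measurable_sum _ fun k _ => ?_)
  refine (Real.measurable_log.comp (measurable_const.add ?_)).div_const _
  exact (measurable_const.mul (hHF k k)).div ((measurable_const.mul
    (Finset.measurable_sum _ fun i _ => hHF k i)).add_const _)

lemma norm_sumRate_le {M L K : ℕ} {P σsq S : ℝ} (hP : 0 < P) (hσ : 0 < σsq)
    (θ : Fin K → ℝ × ℝ) (hS : ∀ k,
      sinr L P σsq (channel M L K θ) (zfPrecoder L (channel M L K θ)) k ≤ S) :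
    ‖sumRate M L K P σsq θ‖ ≤ (K : ℝ) / L * Real.logb 2 (1 + S) := by
  have h0 := sinr_nonneg L hP.le hσ.le (channel M L K θ) (zfPrecoder L (channel M L K θ))
  have hlog : ∀ k, 0 ≤ Real.logb 2
      (1 + sinr L P σsq (channel M L K θ) (zfPrecoder L (channel M L K θ)) k) :=
    fun k => Real.logb_nonneg one_lt_two (by linarith [h0 k])
  rw [sumRate, Real.norm_of_nonneg
    (mul_nonneg (by positivity) (Finset.sum_nonneg fun k _ => hlog k))]
  have hsum : ∑ k : Fin K, Real.logb 2
      (1 + sinr L P σsq (channel M L K θ) (zfPrecoder L (channel M L K θ)) k)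
      ≤ K * Real.logb 2 (1 + S) := by
    refine (Finset.sum_le_card_nsmul _ _ (Real.logb 2 (1 + S)) fun k _ => ?_).trans (by simp)
    exact Real.logb_le_logb_of_le one_lt_two (by linarith [h0 k]) (by linarith [hS k])
  calc _ ≤ 1 / (L : ℝ) * (K * Real.logb 2 (1 + S)) := by gcongr
    _ = _ := by ring

lemma isProbabilityMeasure_cond_Icc {a b : ℝ} (h : a < b) :
    IsProbabilityMeasure (cond (volume : Measure ℝ) (Set.Icc a b)) :=
  cond_isProbabilityMeasure_of_finite (by simp [h]) (by simp)

lemma isProbabilityMeasure_userLaw (K : ℕ) {R H : ℝ} (h : 0 < R / H) :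
    IsProbabilityMeasure (userLaw K R H) := by
  have h2 : R / (2 * H) = R / H / 2 := by rw [div_div, mul_comm]
  have := isProbabilityMeasure_cond_Icc (show -(R / (2 * H)) < R / (2 * H) by linarith)
  have := isProbabilityMeasure_cond_Icc (show (-(1 / 2) : ℝ) < 1 / 2 by norm_num)
  unfold userLaw
  infer_instance

lemma ae_userLaw_abs_fst_le (K : ℕ) {R H : ℝ} (h : 0 < R / H) :
    ∀ᵐ θ ∂(userLaw K R H), ∀ k, |(θ k).1| ≤ R / H / 2 := by
  have h2 : R / (2 * H) = R / H / 2 := by rw [div_div, mul_comm]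
  have := isProbabilityMeasure_cond_Icc (show -(R / (2 * H)) < R / (2 * H) by linarith)
  have := isProbabilityMeasure_cond_Icc (show (-(1 / 2) : ℝ) < 1 / 2 by norm_num)
  refine ae_all_iff.2 fun k => ?_
  refine (Measure.tendsto_eval_ae_ae (i := k)).eventually
    (p := fun x : ℝ × ℝ => |x.1| ≤ R / H / 2) ?_
  refine Measure.quasiMeasurePreserving_fst.ae (p := fun x : ℝ => |x| ≤ R / H / 2) ?_
  filter_upwards [ae_cond_mem measurableSet_Icc] with x hx
  rw [h2] at hx
  exact abs_le.2 hx

lemma integrable_sumRate {M L K : ℕ} (hL : 0 < L) {P σsq R H : ℝ} (hP : 0 < P) (hσ : 0 < σsq)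
    (h : 0 < R / H) : Integrable (sumRate M L K P σsq) (userLaw K R H) := by
  have := isProbabilityMeasure_userLaw K h
  exact .of_bound (measurable_sumRate M L K P σsq).aestronglyMeasurable _
    (ae_of_all _ fun θ => norm_sumRate_le hP hσ θ (sinr_channel_le hL hP hσ θ))

lemma norm_avgSumRate_le {M L K : ℕ} {P σsq R H S : ℝ} (hP : 0 < P) (hσ : 0 < σsq)
    (h : 0 < R / H) (hS : ∀ᵐ θ ∂(userLaw K R H), ∀ k,
      sinr L P σsq (channel M L K θ) (zfPrecoder L (channel M L K θ)) k ≤ S) :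
    ‖avgSumRate M L K P σsq R H‖ ≤ (K : ℝ) / L * Real.logb 2 (1 + S) := by
  have := isProbabilityMeasure_userLaw K h
  refine (norm_integral_le_of_norm_le_const (hS.mono fun θ hθ =>
    norm_sumRate_le hP hσ θ hθ)).trans (le_of_eq ?_)
  simp

/-- Since log(1 + S) ≤ S, the factor L in the SINR bound cancels the 1/L of the rate. -/
lemma norm_avgSumRate_le_of_dense {M L K D : ℕ} (hL : 0 < L) {P σsq R H : ℝ} (hP : 0 < P)
    (hσ : 0 < σsq) (h : 0 < R / H) (hK : L * D < K)
    (hD : 8 * (2 * Real.pi * M * (R / H / 2)) ≤ D) :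
    ‖avgSumRate M L K P σsq R H‖
      ≤ 4 * (P / σsq) / Real.log 2 * ((M : ℝ) * K ^ 2 * (1 / 4) ^ D) := by
  have hLpos : (0 : ℝ) < L := Nat.cast_pos.2 hL
  have hlog2 : 0 < Real.log 2 := Real.log_pos one_lt_two
  refine (norm_avgSumRate_le hP hσ h
    (S := P / σsq * ((M : ℝ) * L * K * (4 * (1 / 4) ^ D))) ?_).trans ?_
  · filter_upwards [ae_userLaw_abs_fst_le K h] with θ hθ k
    refine sinr_channel_le_of_dense hL hP hσ θ k hK fun j => le_trans ?_ hD
    have := hθ j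
    gcongr
  · set S := P / σsq * ((M : ℝ) * L * K * (4 * (1 / 4) ^ D)) with hS
    have hS0 : 0 ≤ S := by positivity
    have hlog : Real.logb 2 (1 + S) ≤ S / Real.log 2 := by
      rw [Real.logb]
      gcongr
      linarith [Real.log_le_sub_one_of_pos (show 0 < 1 + S by linarith)]
    calc (K : ℝ) / L * Real.logb 2 (1 + S) ≤ (K : ℝ) / L * (S / Real.log 2) := by gcongr
      _ = _ := by rw [hS]; field_simp

/-- Rounding a real number `x ≥ 1` to an adjacent positive integer changes it by a factor of at
most two. -/
lemma rounding_bounds {n : ℕ} {x : ℝ} (hx : 1 ≤ x) (h : |(n : ℝ) - x| < 1) :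
    0 < n ∧ x / 2 ≤ n ∧ (n : ℝ) ≤ 2 * x := by
  obtain ⟨h1, h2⟩ := abs_lt.1 h
  have hn : 0 < n := by
    have : (0 : ℝ) < n := by linarith
    exact_mod_cast this
  have hn1 : (1 : ℝ) ≤ n := by exact_mod_cast hn
  exact ⟨hn, by linarith, by linarith⟩

end STAB

/-! ### Asymptotics in both regimes -/

theorem theorem2 (p q r P σsq : ℝ) (hp0 : 0 ≤ p) (hp1 : p ≤ 1) (hq : 0 ≤ q)
    (hr0 : 0 ≤ r) (hr1 : r < 1) (hP : 0 < P) (hσ : 0 < σsq)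
    (K L : ℕ → ℕ) (R H : ℕ → ℝ)
    -- `K = M ^ p` and `L = M ^ q`, rounded to an adjacent integer in any way
    (hK : ∀ M : ℕ, 1 ≤ M → |(K M : ℝ) - (M : ℝ) ^ p| < 1)
    (hL : ∀ M : ℕ, 1 ≤ M → |(L M : ℝ) - (M : ℝ) ^ q| < 1)
    (hH : ∀ M : ℕ, 1 ≤ M → 0 < H M)
    (hR : ∀ M : ℕ, 1 ≤ M → R M / H M = (M : ℝ) ^ (-r)) :
    -- the expectations exist
    (∀ M : ℕ, 1 ≤ M → Integrable (STAB.sumRate M (L M) (K M) P σsq)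
      (STAB.userLaw (K M) (R M) (H M))) ∧
    -- sparse/critical regime
    (p + r - 1 ≤ q →
      (fun M : ℕ => STAB.avgSumRate M (L M) (K M) P σsq (R M) (H M)) =O[atTop]
        (fun M : ℕ => (M : ℝ) ^ (p - q) * Real.log M)) ∧
    -- dense regime
    (q < p + r - 1 →
      Tendsto (fun M : ℕ => STAB.avgSumRate M (L M) (K M) P σsq (R M) (H M)) atTop (nhds 0)) := by
  have hM1 : ∀ M : ℕ, 1 ≤ M → (1 : ℝ) ≤ M := fun M hM => by exact_mod_cast hM
  have hKb := fun M hM => STAB.rounding_bounds (Real.one_le_rpow (hM1 M hM) hp0) (hK M hM)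
  have hLb := fun M hM => STAB.rounding_bounds (Real.one_le_rpow (hM1 M hM) hq) (hL M hM)
  have hRH : ∀ M : ℕ, 1 ≤ M → 0 < R M / H M := fun M hM => by
    rw [hR M hM]
    exact Real.rpow_pos_of_pos (one_pos.trans_le (hM1 M hM)) _
  have hρ : 0 < P / σsq := div_pos hP hσ
  have hlog2 : 0 < Real.log 2 := Real.log_pos one_lt_two
  refine ⟨fun M hM => STAB.integrable_sumRate (hLb M hM).1 hP hσ (hRH M hM), fun _ => ?_,
    fun hdense => ?_⟩
  · refine IsBigO.of_bound
      -- The 4 is the rounding loss in K/L; M ≥ 2 lets log M / log 2 absorb the additive constant.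
      (4 * ((Real.log (1 + 2 * (P / σsq)) / Real.log 2 + (1 + q)) / Real.log 2)) ?_
    filter_upwards [eventually_ge_atTop 2] with M hM2
    have hM : 1 ≤ M := one_le_two.trans hM2
    have hMpos : (0 : ℝ) < M := one_pos.trans_le (hM1 M hM)
    have hlogM : Real.log 2 ≤ Real.log M := Real.log_le_log two_pos (by exact_mod_cast hM2)
    obtain ⟨hL0, hLl, hLu⟩ := hLb M hM
    obtain ⟨-, -, hKu⟩ := hKb M hM
    have hpp : 0 < (M : ℝ) ^ p := Real.rpow_pos_of_pos hMpos p
    have hqp : 0 < (M : ℝ) ^ q := Real.rpow_pos_of_pos hMpos q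
    have hKL : (K M : ℝ) / L M ≤ 4 * (M : ℝ) ^ (p - q) := by
      rw [Real.rpow_sub hMpos]
      calc (K M : ℝ) / L M ≤ (2 * (M : ℝ) ^ p) / ((M : ℝ) ^ q / 2) := by gcongr
        _ = _ := by field_simp; norm_num
    have harg : 1 + P / σsq * ((M : ℝ) * L M) ≤ (1 + 2 * (P / σsq)) * (M : ℝ) ^ (1 + q) := by
      have h1 : 1 ≤ (M : ℝ) ^ (1 + q) := Real.one_le_rpow (hM1 M hM) (by linarith)
      have h2 : (M : ℝ) * L M ≤ 2 * (M : ℝ) ^ (1 + q) := by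
        rw [Real.rpow_add hMpos, Real.rpow_one]
        nlinarith
      nlinarith [mul_le_mul_of_nonneg_left h2 hρ.le]
    have hc : 0 ≤ Real.log (1 + 2 * (P / σsq)) := Real.log_nonneg (by linarith)
    have hlog : Real.logb 2 (1 + P / σsq * ((M : ℝ) * L M)) ≤
        (Real.log (1 + 2 * (P / σsq)) / Real.log 2 + (1 + q)) / Real.log 2 * Real.log M := by
      rw [Real.logb, div_mul_eq_mul_div _ (Real.log 2)]
      gcongr
      refine (Real.log_le_log (by positivity) harg).trans ?_
      rw [Real.log_mul (by positivity) (by positivity), Real.log_rpow hMpos,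
        add_mul (_ / _)]
      gcongr
      rw [div_mul_eq_mul_div _ (Real.log 2), le_div_iff₀ hlog2]
      exact mul_le_mul_of_nonneg_left hlogM hc
    have hlog0 : 0 ≤ Real.logb 2 (1 + P / σsq * ((M : ℝ) * L M)) :=
      Real.logb_nonneg one_lt_two (by
        have : 0 ≤ P / σsq * ((M : ℝ) * L M) := by positivity
        linarith)
    refine (STAB.norm_avgSumRate_le hP hσ (hRH M hM) (ae_of_all _ fun θ =>
      STAB.sinr_channel_le hL0 hP hσ θ)).trans ?_
    rw [Real.norm_of_nonneg (by positivity)]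
    calc _ ≤ 4 * (M : ℝ) ^ (p - q) *
          ((Real.log (1 + 2 * (P / σsq)) / Real.log 2 + (1 + q)) / Real.log 2 * Real.log M) := by
          gcongr
      _ = _ := by ring
  · have hs : 0 < 1 - r := by linarith
    have hgap : 0 < p + r - 1 - q := by linarith
    have hcast : Tendsto (fun M : ℕ => (M : ℝ)) atTop atTop := tendsto_natCast_atTop_atTop
    -- With y = M^(1-r), LD ≤ 2M^q · 33y while K ≥ M^p/2, so any constant above 132 works.
    have hbig : ∀ᶠ M : ℕ in atTop, 133 ≤ (M : ℝ) ^ (p + r - 1 - q) :=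
      ((tendsto_rpow_atTop hgap).comp hcast).eventually_ge_atTop 133
    -- The power of y = M^(1-r) is M³, from M·K² with K ≤ 2M.
    have hlim : Tendsto (fun M : ℕ => 4 * (P / σsq) / Real.log 2 *
        (4 * (((M : ℝ) ^ (1 - r)) ^ (3 / (1 - r)) * Real.exp (-1 * (M : ℝ) ^ (1 - r)))))
        atTop (nhds 0) := by
      have h := (tendsto_rpow_mul_exp_neg_mul_atTop_nhds_zero (3 / (1 - r)) 1 one_pos).comp
        ((tendsto_rpow_atTop hs).comp hcast)
      simpa using (h.const_mul 4).const_mul (4 * (P / σsq) / Real.log 2)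
    refine squeeze_zero_norm' ?_ hlim
    filter_upwards [hbig, eventually_ge_atTop 1] with M hMbig hM
    have hMpos : (0 : ℝ) < M := one_pos.trans_le (hM1 M hM)
    obtain ⟨hL0, hLl, hLu⟩ := hLb M hM
    obtain ⟨hK0, hKl, hKu⟩ := hKb M hM
    set y := (M : ℝ) ^ (1 - r) with hy
    have hy1 : 1 ≤ y := Real.one_le_rpow (hM1 M hM) hs.le
    -- The Taylor order must be at least 8πy, and π ≤ 4.
    have hDl : 32 * y ≤ (⌈32 * y⌉₊ : ℝ) := Nat.le_ceil _
    have hDu : (⌈32 * y⌉₊ : ℝ) ≤ 33 * y := by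
      linarith [Nat.ceil_lt_add_one (show 0 ≤ 32 * y by linarith)]
    have hpp : 0 < (M : ℝ) ^ p := Real.rpow_pos_of_pos hMpos p
    have hqp : 0 < (M : ℝ) ^ q := Real.rpow_pos_of_pos hMpos q
    have hLD : L M * ⌈32 * y⌉₊ < K M := by
      have hsplit : (M : ℝ) ^ p = (M : ℝ) ^ (p + r - 1 - q) * ((M : ℝ) ^ q * y) := by
        rw [hy, ← Real.rpow_add hMpos, ← Real.rpow_add hMpos]
        ring_nf
      have h1 : (L M : ℝ) * ⌈32 * y⌉₊ ≤ (2 * (M : ℝ) ^ q) * (33 * y) := by gcongr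
      have h2 : 133 * ((M : ℝ) ^ q * y) ≤ (M : ℝ) ^ p := by
        rw [hsplit]
        gcongr
      have h3 : 0 < (M : ℝ) ^ q * y := by positivity
      have : (L M : ℝ) * ⌈32 * y⌉₊ < K M := by nlinarith
      exact_mod_cast this
    have hD : 8 * (2 * Real.pi * M * (R M / H M / 2)) ≤ (⌈32 * y⌉₊ : ℝ) := by
      have hMy : (M : ℝ) * (M : ℝ) ^ (-r) = y := by
        rw [hy, sub_eq_add_neg, Real.rpow_add hMpos, Real.rpow_one]
      rw [hR M hM]
      have : 8 * (2 * Real.pi * M * ((M : ℝ) ^ (-r) / 2)) = 8 * Real.pi * y := by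
        rw [← hMy]; ring
      rw [this]
      refine le_trans ?_ hDl
      nlinarith [Real.pi_le_four]
    refine (STAB.norm_avgSumRate_le_of_dense hL0 hP hσ (hRH M hM) hLD hD).trans ?_
    have hKM : (K M : ℝ) ≤ 2 * M := by
      have : (M : ℝ) ^ p ≤ M := by
        simpa using Real.rpow_le_rpow_of_exponent_le (hM1 M hM) hp1
      linarith
    have hy3 : y ^ (3 / (1 - r)) = (M : ℝ) ^ 3 := by
      rw [hy, ← Real.rpow_mul hMpos.le, mul_div_cancel₀ _ hs.ne']
      exact_mod_cast Real.rpow_natCast (M : ℝ) 3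
    have hexp : (1 / 4 : ℝ) ^ ⌈32 * y⌉₊ ≤ Real.exp (-1 * y) := by
      have h4 : (1 / 4 : ℝ) ≤ Real.exp (-1) := by
        rw [Real.exp_neg, one_div]
        exact inv_anti₀ (Real.exp_pos _) (by linarith [Real.exp_one_lt_d9])
      calc (1 / 4 : ℝ) ^ ⌈32 * y⌉₊ ≤ Real.exp (-1) ^ ⌈32 * y⌉₊ := by gcongr
        _ = Real.exp (⌈32 * y⌉₊ * -1) := (Real.exp_nat_mul _ _).symm
        _ ≤ _ := Real.exp_le_exp.2 (by linarith)
    rw [hy3]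
    calc _ ≤ 4 * (P / σsq) / Real.log 2 * ((M : ℝ) * (2 * M) ^ 2 * Real.exp (-1 * y)) := by gcongr
      _ = _ := by ring
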